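/- Let $\mathcal G$ be a parity game with integer-valued costs: a finite directed graph $(V,E)$ with $n=|V|$ vertices in which every vertex has a successor, a partition of $V$ into positions $V_0$ of Player $0$ and $V_1$ of Player $1$, an initial vertex $v_I$, a coloring $\Omega\colon V\to\mathbb N$ and a cost function $\mathrm{Cst}\colon E\to\mathbb N$ (parity games with abstract costs $\varepsilon,\mathbf i$ are the case where all costs are $0$ or $1$). Let $d$ be the number of distinct odd colors occurring in $\mathcal G$. Plays are infinite paths from $v_I$. For a play $\rho=v_0v_1v_2\cdots$ let $\mathrm{Cor}(\rho,j)$ be the minimum of $\sum_{k=j}^{j'-1}\mathrm{Cst}(v_k,v_{k+1})$ over all $j'\ge j$ such that $\Omega(v_{j'})$ is even and $\Omega(v_{j'})\ge\Omega(v_j)$ (with $\min\emptyset=\infty$), and let $\mathrm{Cst}(\rho)=\limsup_{j\to\infty}\mathrm{Cor}(\rho,j)$. A strategy for Player $i$ is a map $\sigma\colon V^*V_i\to V$ with $(v,\sigma(wv))\in E$ for all $wv\in V^*V_i$; a play $v_0v_1\cdots$ is consistent with $\sigma$ if $v_{j+1}=\sigma(v_0\cdots v_j)$ whenever $v_j\in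 V_i$. For a strategy $\sigma$ of Player $0$ let $\mathrm{Cst}(\sigma)=\sup_\rho\mathrm{Cst}(\rho)$, and for a strategy $\tau$ of Player $1$ let $\mathrm{Cst}(\tau)=\inf_\rho\mathrm{Cst}(\rho)$, where $\rho$ ranges over the plays consistent with the respective strategy. A strategy for Player $i$ is implemented with $k$ memory states if there are a set $M$ with $|M|=k$, an initial state $m_I\in M$, an update function $\mathrm{Upd}\colon M\times E\to M$ and a next-move function $\mathrm{Nxt}\colon V_i\times M\to V$ with $(v,\mathrm{Nxt}(v,m))\in E$ for all $v\in V_i$, $m\in M$, such that the move after every finite path $v_0\cdots v_j$ with $v_j\in V_i$ is $\mathrm{Nxt}(v_j,m_j)$, where $m_0=m_I$ and $m_{k+1}=\mathrm{Upd}(m_k,(v_k,v_{k+1}))$. Let $b\in\mathbb N$. Then: 1. If Player $0$ has a strategy $\sigma$ for $\mathcal G$ with $\mathrm{Cst}(\sigma)=b$, then she also has a strategy $\sigma'$ with $\mathrm{Cst}(\sigma')\le b$ that is implemented with $(b+2)^d$ memory states. 2. If Player $1$ has a strategy $\tau$ for $\mathcal G$ with $\mathrm{Cst}(\tau)=b$,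 then he also has a strategy $\tau'$ with $\mathrm{Cst}(\tau')\ge b$ that is implemented with $n(b+2)^d$ memory states. -/

import Mathlib

noncomputable section

namespace CostParity

/-- The two players, `0` and `1`. -/
abbrev Player := Fin 2

/-- An arena with vertex set `V` (finiteness of `V` is assumed where it is used): a directed graph,
a partition of its vertices into the positions `{v | owner v = 0}` of Player 0 and
`{v | owner v = 1}` of Player 1, and an initial vertex. Every vertex is non-terminal. -/
structure Arena (V : Type*) where
  owner : V → Player
  Edge : V → V → Prop
  init : V
  nonterminal : ∀ v, ∃ v', Edge v v'

variable {V : Type*}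

namespace Arena

/-- A play is an infinite path through the graph that starts in the initial vertex. -/
def IsPlay (A : Arena V) (ρ : ℕ → V) : Prop :=
  ρ 0 = A.init ∧ ∀ j, A.Edge (ρ j) (ρ (j + 1))

/-- A strategy for Player `i` maps every word `w v`, where `v` is a position of Player `i`,
to a successor of `v`. -/
structure Strategy (A : Arena V) (i : Player) where
  move : List V → {v : V // A.owner v = i} → V
  legal : ∀ w v, A.Edge v.1 (move w v)

/-- `ρ` is a play with `ρ (j + 1) = σ (ρ 0 ⋯ ρ j)` for every `j` such that `ρ j` is a position
of Player `i`. -/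
def Strategy.ConsistentPlay {A : Arena V} {i : Player} (σ : A.Strategy i) (ρ : ℕ → V) : Prop :=
  A.IsPlay ρ ∧
    ∀ (j : ℕ) (h : A.owner (ρ j) = i), ρ (j + 1) = σ.move ((List.range j).map ρ) ⟨ρ j, h⟩

end Arena

/-- A memory structure with set of memory states `M`. The value `upd m v v'` is the update of `m`
along the edge `(v, v')`; values at pairs that are not edges play no role in any play. -/
structure MemoryStructure (V M : Type*) where
  init : M
  upd : M → V → V → M

namespace MemoryStructure

variable {M : Type*}

/-- The extension of the update function to finite play prefixes. -/
def updPlus (mem : MemoryStructure V M) : M → List V → M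
  | m, [] => m
  | m, [_] => m
  | m, v :: v' :: w => mem.updPlus (mem.upd m v v') (v' :: w)

/-- The memory state along a prefix of length one is the initial one. -/
theorem updPlus_singleton (mem : MemoryStructure V M) (m : M) (v : V) :
    mem.updPlus m [v] = m := by
  simp [updPlus]

/-- `Upd⁺(m, w v v') = Upd(Upd⁺(m, w v), (v, v'))`. -/
theorem updPlus_append (mem : MemoryStructure V M) (m : M) (w : List V) (v v' : V) :
    mem.updPlus m (w ++ [v, v']) = mem.upd (mem.updPlus m (w ++ [v])) v v' := by
  induction w generalizing m with
  | nil => simp [updPlus]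
  | cons a w ih =>
    cases w with
    | nil => simp [updPlus]
    | cons c w => simpa [updPlus] using ih (mem.upd m a c)

end MemoryStructure

/-- `σ` is implemented by the memory structure `mem`: for some next-move function `nxt`
(whose moves are legal), `σ(v₀ ⋯ vⱼ) = nxt(vⱼ, Upd⁺(m_I, v₀ ⋯ vⱼ))`. -/
def Arena.Strategy.ImplementedBy {A : Arena V} {i : Player} {M : Type*} (σ : A.Strategy i)
    (mem : MemoryStructure V M) : Prop :=
  ∃ nxt : {v : V // A.owner v = i} → M → V,
    (∀ v m, A.Edge v.1 (nxt v m)) ∧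
    ∀ w v, σ.move w v = nxt v (mem.updPlus mem.init (w ++ [v.1]))

/-- `σ` is implemented by some memory structure with `k` memory states. -/
def Arena.Strategy.HasMemory {A : Arena V} {i : Player} (σ : A.Strategy i) (k : ℕ) : Prop :=
  ∃ (M : Type) (_ : Fintype M) (mem : MemoryStructure V M),
    Fintype.card M = k ∧ σ.ImplementedBy mem

/-- A parity game with (non-negative) integer-valued costs. The number `cost v v'` is the cost of
the edge `(v, v')`; values at pairs that are not edges play no role in any play. A parity game with
(abstract) costs, whose edges are ε-edges or increment-edges, is the special case in which every
edge has cost `0` or `1`. -/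
structure Game (V : Type*) extends Arena V where
  color : V → ℕ
  cost : V → V → ℕ

namespace Game

/-- The colors that answer a request of color `c`. -/
def answer (c : ℕ) : Set ℕ := {c' | c ≤ c' ∧ Even c'}

/-- The cost of the infix `ρ j ⋯ ρ j'` of `ρ`. -/
def infixCost (G : Game V) (ρ : ℕ → V) (j j' : ℕ) : ℕ :=
  ∑ k ∈ Finset.Ico j j', G.cost (ρ k) (ρ (k + 1))

/-- The cost-of-response at position `j` of `ρ`, which is `⊤` if the request at `j` is never
answered. -/
def cor (G : Game V) (ρ : ℕ → V) (j : ℕ) : ℕ∞ :=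
  ⨅ j' ∈ {j' : ℕ | j ≤ j' ∧ G.color (ρ j') ∈ answer (G.color (ρ j))}, (G.infixCost ρ j j' : ℕ∞)

/-- The cost of a play. -/
def playCost (G : Game V) (ρ : ℕ → V) : ℕ∞ :=
  Filter.limsup (fun j => G.cor ρ j) Filter.atTop

/-- The cost of a strategy for Player 0: the supremum of the costs of the consistent plays. -/
def cost₀ (G : Game V) (σ : G.toArena.Strategy 0) : ℕ∞ :=
  ⨆ ρ ∈ {ρ : ℕ → V | σ.ConsistentPlay ρ}, G.playCost ρ

/-- The cost of a strategy for Player 1: the infimum of the costs of the consistent plays. -/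
def cost₁ (G : Game V) (τ : G.toArena.Strategy 1) : ℕ∞ :=
  ⨅ ρ ∈ {ρ : ℕ → V | τ.ConsistentPlay ρ}, G.playCost ρ

/-- The number of odd colors that occur in the game. -/
def numOddColors (G : Game V) : ℕ := {c : ℕ | Odd c ∧ ∃ v, G.color v = c}.ncard

end Game

end CostParity

end

namespace CostParity

open Filter

/-! Fix `b`. A memory recording, for each odd color, the cost accumulated by its oldest open request
(a value in `0, …, b`, or none) has `(b + 2) ^ d` states. When some recorded cost would exceed `b`,
an overflow occurs and all records are dropped, so that infinitely many overflows witness infinitely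
many distinct expensive requests rather than a single unanswered one. On the product of arena and
memory, consider the parity game in which overflows get an odd color above all others. If Player 0
wins a play, overflows stop and an even color recurs that answers every late request, so the cost is
at most `b` (`playCost_le_of_parityWin`). If Player 1 wins, the cost is at least `b + 1`
(`lt_playCost_of_parityWin`).

Positional determinacy on the product (`exists_positional`) gives the dichotomy
`exists_hasMemory_or`. Playing a given strategy against the unwanted alternative rules that
alternative out. Player 1 uses the dichotomy for `b - 1`. -/

theorem Player.eq_or_eq {i j : Player} (hij : i ≠ j) (o : Player) : o = i ∨ o = j := by
  revert i j o
  decide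

/-- The parity condition of Player `i`: the maximal color occurring infinitely often in `c` exists
and has parity `i`. -/
def ParityWin (i : Player) (c : ℕ → ℕ) : Prop :=
  ∃ m : ℕ, m % 2 = i.val ∧ (∃ᶠ n in atTop, c n = m) ∧ ∀ᶠ n in atTop, c n ≤ m

theorem ParityWin.of_shift {i : Player} {c : ℕ → ℕ} (N : ℕ)
    (h : ParityWin i fun n => c (n + N)) : ParityWin i c := by
  obtain ⟨m, hm, hf, he⟩ := h
  refine ⟨m, hm, ?_, ?_⟩
  · rw [frequently_atTop] at hf ⊢
    intro a
    obtain ⟨n, hn, h⟩ := hf a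
    exact ⟨n + N, by omega, h⟩
  · rw [eventually_atTop] at he ⊢
    obtain ⟨a, ha⟩ := he
    refine ⟨a + N, fun n hn => ?_⟩
    have := ha (n - N) (by omega)
    dsimp only at this
    rwa [Nat.sub_add_cancel (by omega)] at this

theorem ParityWin.unique {i j : Player} {c : ℕ → ℕ} (hi : ParityWin i c) (hj : ParityWin j c) :
    i = j := by
  obtain ⟨m, hm, hf, he⟩ := hi
  obtain ⟨m', hm', hf', he'⟩ := hj
  obtain ⟨n, rfl, h⟩ := (hf.and_eventually he').exists
  obtain ⟨n', rfl, h'⟩ := (hf'.and_eventually he).exists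
  exact Fin.ext (by omega)

/-- A parity game on the set of positions `P` whose colors are attached to the edges. -/
structure EdgeGame (P : Type*) where
  owner : P → Player
  Edge : P → P → Prop
  color : P → P → ℕ
  nonterminal : ∀ p, ∃ q, Edge p q

/-! ### Positional determinacy of finite parity games with colored edges. -/

namespace EdgeGame

variable {P : Type*} (H : EdgeGame P)

/-- An edge from `p` to `q` is safe with respect to `W` and `T` if its color is smaller than `k` and
`q ∈ W`, or its color is at least `k` and it belongs to `T`. -/
def Safe (k : ℕ) (T : P → P → Prop) (W : Set P) (p q : P) : Prop :=
  (H.color p q < k → q ∈ W) ∧ (k ≤ H.color p q → T p q)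

/-- The positional strategy `s` of Player `i` wins from every position in `W` the game that stops
as soon as an edge of color at least `k` is taken, such an edge being good for Player `i` if it
belongs to `T`, and in which infinite plays are evaluated by the parity condition. -/
structure Solves (k : ℕ) (i : Player) (T : P → P → Prop) (W : Set P) (s : P → P) : Prop where
  own : ∀ p ∈ W, H.owner p = i → H.Edge p (s p) ∧ H.Safe k T W p (s p)
  opp : ∀ p ∈ W, H.owner p ≠ i → ∀ q, H.Edge p q → H.Safe k T W p q
  win : ∀ ρ : ℕ → P, (∀ n, ρ n ∈ W) → (∀ n, H.Edge (ρ n) (ρ (n + 1))) →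
    (∀ n, H.color (ρ n) (ρ (n + 1)) < k) → (∀ n, H.owner (ρ n) = i → ρ (n + 1) = s (ρ n)) →
    ParityWin i fun n => H.color (ρ n) (ρ (n + 1))

variable {H}

theorem Solves.safe {k : ℕ} {i : Player} {T : P → P → Prop} {W : Set P} {s : P → P}
    (h : H.Solves k i T W s) {p q : P} (hp : p ∈ W) (hE : H.Edge p q)
    (hs : H.owner p = i → q = s p) : H.Safe k T W p q := by
  by_cases ho : H.owner p = i
  · rw [hs ho]
    exact (h.own p hp ho).2
  · exact h.opp p hp ho q hE

/-- From a position in `W \ W'`, playing `s` against `t` stays in both regions and never takes an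
edge of color at least `k`, which would lie in `T` but not in `T'`. Both players would win the
resulting infinite play. -/
theorem Solves.mono {k : ℕ} {i j : Player} (hij : i ≠ j) {T T' : P → P → Prop} {W W' : Set P}
    {s t : P → P} (h : H.Solves k i T W s) (h' : H.Solves k j (fun p q => ¬ T' p q) W'ᶜ t)
    (hT : ∀ p q, T p q → T' p q) : W ⊆ W' := by
  intro p hp
  by_contra hp'
  have hor : ∀ p, H.owner p = i ∨ H.owner p = j :=
    fun p => Player.eq_or_eq hij _
  classical
  let f : P → P := fun p => if H.owner p = i then s p else t p
  have hfi : ∀ p, H.owner p = i → f p = s p := fun p hi => if_pos hi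
  have hfj : ∀ p, H.owner p = j → f p = t p := fun p hj => if_neg (by rw [hj]; exact hij.symm)
  have hE : ∀ p, p ∈ W → p ∈ W'ᶜ → H.Edge p (f p) := by
    intro p hp hp'
    rcases hor p with hi | hj
    · rw [hfi p hi]; exact (h.own p hp hi).1
    · rw [hfj p hj]; exact (h'.own p hp' hj).1
  have key : ∀ p, p ∈ W → p ∈ W'ᶜ → H.color p (f p) < k ∧ f p ∈ W ∧ f p ∈ W'ᶜ := by
    intro p hp hp'
    have h1 := h.safe hp (hE p hp hp') (hfi p)
    have h2 := h'.safe hp' (hE p hp hp') (hfj p)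
    have hk : H.color p (f p) < k := by
      by_contra hk
      exact h2.2 (not_lt.mp hk) (hT _ _ (h1.2 (not_lt.mp hk)))
    exact ⟨hk, h1.1 hk, h2.1 hk⟩
  let ρ : ℕ → P := fun n => f^[n] p
  have hρ : ∀ n, ρ (n + 1) = f (ρ n) := fun n => Function.iterate_succ_apply' f n p
  have hmem : ∀ n, ρ n ∈ W ∧ ρ n ∈ W'ᶜ := by
    intro n
    induction n with
    | zero => exact ⟨hp, hp'⟩
    | succ n ih => rw [hρ]; exact (key _ ih.1 ih.2).2
  have hEρ : ∀ n, H.Edge (ρ n) (ρ (n + 1)) := fun n => by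
    rw [hρ]; exact hE _ (hmem n).1 (hmem n).2
  have hcρ : ∀ n, H.color (ρ n) (ρ (n + 1)) < k := fun n => by
    rw [hρ]; exact (key _ (hmem n).1 (hmem n).2).1
  exact hij ((h.win ρ (fun n => (hmem n).1) hEρ hcρ fun n hi => by rw [hρ, hfi _ hi]).unique
    (h'.win ρ (fun n => (hmem n).2) hEρ hcρ fun n hj => by rw [hρ, hfj _ hj]))

/-- Extending the edges to be passed from those of color less than `k` to those of color `k`,
if `k` has the parity of Player `i`. -/
theorem exists_solves_succ [Finite P] {k : ℕ} {i j : Player} (hij : i ≠ j) (hk : k % 2 = i.val)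
    (ih : ∀ T : P → P → Prop, ∃ (W : Set P) (s t : P → P),
      H.Solves k i T W s ∧ H.Solves k j (fun p q => ¬ T p q) Wᶜ t) (T : P → P → Prop) :
    ∃ (W : Set P) (s t : P → P),
      H.Solves (k + 1) i T W s ∧ H.Solves (k + 1) j (fun p q => ¬ T p q) Wᶜ t := by
  classical
  -- Edges of color `k` now stop the play and are good for Player `i` when they lead into `Z`. The
  -- region sought is the greatest fixed point of `F`, reached by iterating from `Set.univ`.
  let TZ : Set P → P → P → Prop := fun Z p q => if H.color p q = k then q ∈ Z else T p q
  choose F s t hs ht using fun Z => ih (TZ Z)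
  have hF : Monotone F := by
    intro Z Z' hZ
    refine (hs Z).mono hij (ht Z') fun p q h => ?_
    simp only [TZ] at h ⊢
    split_ifs at h ⊢
    · exact hZ h
    · exact h
  let Z : ℕ → Set P := fun n => F^[n] Set.univ
  have hZ : ∀ n, Z (n + 1) = F (Z n) := fun n => Function.iterate_succ_apply' F n _
  have hanti : Antitone Z := by
    refine antitone_nat_of_succ_le fun n => ?_
    induction n with
    | zero => exact Set.subset_univ _
    | succ n ihn => rw [hZ, hZ n]; exact hF (hZ n ▸ ihn)
  obtain ⟨N, hN⟩ := WellFoundedLT.antitone_chain_condition hanti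
  have hfix : F (Z N) = Z N := by rw [← hZ, hN (N + 1) (by omega)]
  have hsub : ∀ n, Z N ⊆ Z n := by
    intro n
    rcases le_total n N with h | h
    · exact hanti h
    · exact (hN n h).le
  -- Player `j` plays from `p` the strategy for the stage `Z r` with `r` minimal such that `p ∉ F (Z
  -- r)`. This rank never increases while colors stay at most `k`, and drops on color `k`, so
  -- eventually a single strategy is followed and color `k` is avoided.
  refine ⟨Z N, s (Z N), fun p => t (Z (sInf {r | p ∉ Z (r + 1)})) p, ?_, ?_⟩
  · have hsN := hs (Z N)
    rw [hfix] at hsN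
    have hsafe : ∀ p q, H.Safe k (TZ (Z N)) (Z N) p q → H.Safe (k + 1) T (Z N) p q := by
      intro p q ⟨h1, h2⟩
      simp only [TZ] at h2
      refine ⟨fun h => ?_, fun h => ?_⟩
      · rcases (Nat.lt_succ_iff_lt_or_eq.mp h) with h | h
        · exact h1 h
        · simpa [h] using h2
      · have := h2 (by omega)
        rwa [if_neg (by omega)] at this
    refine ⟨fun p hp ho => ⟨(hsN.own p hp ho).1, hsafe _ _ (hsN.own p hp ho).2⟩,
      fun p hp ho q hE => hsafe _ _ (hsN.opp p hp ho q hE), fun ρ hW hE hc hcon => ?_⟩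
    by_cases hfreq : ∃ᶠ n in atTop, H.color (ρ n) (ρ (n + 1)) = k
    · exact ⟨k, hk, hfreq, Eventually.of_forall fun n => Nat.lt_succ_iff.mp (hc n)⟩
    · rw [not_frequently, eventually_atTop] at hfreq
      obtain ⟨a, ha⟩ := hfreq
      refine ParityWin.of_shift a ?_
      have := hsN.win (fun n => ρ (n + a)) (fun n => hW _)
        (fun n => by simpa only [Nat.add_right_comm n 1 a] using hE (n + a))
        (fun n => by
          have h1 := ha (n + a) (by omega)
          have h2 := hc (n + a)
          simp only [Nat.add_right_comm n 1 a]
          omega)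
        (fun n h => by simpa only [Nat.add_right_comm n 1 a] using hcon (n + a) h)
      simpa only [Nat.add_right_comm _ 1 a] using this
  · set rk : P → ℕ := fun p => sInf {r | p ∉ Z (r + 1)}
    have hrk_mem : ∀ p, p ∈ (Z N)ᶜ → p ∈ (F (Z (rk p)))ᶜ := by
      intro p hp
      rw [← hZ]
      exact Nat.sInf_mem (s := {r | p ∉ Z (r + 1)}) ⟨N, fun h => hp (by
        rwa [hN (N + 1) (by omega)])⟩
    have hrk_le : ∀ p r, p ∉ Z (r + 1) → rk p ≤ r := fun p r h => Nat.sInf_le h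
    have hstep : ∀ p q r, H.Safe k (fun p q => ¬ TZ (Z r) p q) (F (Z r))ᶜ p q →
        H.Safe (k + 1) (fun p q => ¬ T p q) (Z N)ᶜ p q ∧
        (H.color p q < k + 1 → rk q ≤ r ∧ (H.color p q = k → rk q < r)) := by
      intro p q r ⟨h1, h2⟩
      simp only [TZ] at h2
      rw [← hZ] at h1
      have h3 : H.color p q = k → q ∉ Z r := fun h => by simpa [h] using h2
      have h4 : H.color p q = k → rk q < r := by
        intro h
        cases r with
        | zero => exact absurd (Set.mem_univ q) (h3 h)
        | succ r => exact Nat.lt_succ_of_le (hrk_le q r (h3 h))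
      refine ⟨⟨fun h hq => ?_, fun h => ?_⟩, fun h => ⟨?_, h4⟩⟩
      · rcases (Nat.lt_succ_iff_lt_or_eq.mp h) with h | h
        · exact h1 h (hsub _ hq)
        · exact h3 h (hsub _ hq)
      · have := h2 (by omega)
        rwa [if_neg (by omega)] at this
      · rcases (Nat.lt_succ_iff_lt_or_eq.mp h) with h | h
        · exact hrk_le _ _ (h1 h)
        · exact (h4 h).le
    refine ⟨fun p hp ho => ?_, fun p hp ho q hE => ?_, fun ρ hW hE hc hcon => ?_⟩
    · have := (ht (Z (rk p))).own p (hrk_mem p hp) ho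
      exact ⟨this.1, (hstep _ _ _ this.2).1⟩
    · exact (hstep _ _ _ ((ht (Z (rk p))).opp p (hrk_mem p hp) ho q hE)).1
    · have hsafe : ∀ n, rk (ρ (n + 1)) ≤ rk (ρ n) ∧
          (H.color (ρ n) (ρ (n + 1)) = k → rk (ρ (n + 1)) < rk (ρ n)) := fun n =>
        (hstep _ _ _ ((ht (Z (rk (ρ n)))).safe (hrk_mem _ (hW n)) (hE n) (hcon n))).2 (hc n)
      have hra : Antitone fun n => rk (ρ n) := antitone_nat_of_succ_le fun n => (hsafe n).1
      obtain ⟨a, ha⟩ := WellFoundedLT.antitone_chain_condition hra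
      have ha' : ∀ n, rk (ρ (n + a)) = rk (ρ a) := fun n => (ha (n + a) (by omega)).symm
      refine ParityWin.of_shift a ?_
      have := (ht (Z (rk (ρ a)))).win (fun n => ρ (n + a))
        (fun n => by have := hrk_mem _ (hW (n + a)); rwa [ha'] at this)
        (fun n => by simpa only [Nat.add_right_comm n 1 a] using hE (n + a))
        (fun n => by
          have h1 := (hsafe (n + a)).2
          have h2 := hc (n + a)
          have h3 := ha' n
          have h4 := ha' (n + 1)
          simp only [Nat.add_right_comm n 1 a] at h4 ⊢
          omega)
        (fun n h => by
          have := hcon (n + a) h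
          rw [show sInf {r | ρ (n + a) ∉ Z (r + 1)} = rk (ρ a) from ha' n] at this
          simpa only [Nat.add_right_comm n 1 a] using this)
      simpa only [Nat.add_right_comm _ 1 a] using this

theorem Solves.compl_swap {k : ℕ} {i j : Player} {W : Set P} {T : P → P → Prop} {s t : P → P}
    (h : H.Solves k i (fun p q => ¬ T p q) W s ∧ H.Solves k j (fun p q => ¬ ¬ T p q) Wᶜ t) :
    ∃ (W : Set P) (s t : P → P),
      H.Solves k j T W s ∧ H.Solves k i (fun p q => ¬ T p q) Wᶜ t := by
  simp only [not_not] at h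
  exact ⟨Wᶜ, t, s, h.2, by simpa using h.1⟩

/-- Induction on `k`: for `k = 0` every play stops after one move. The inductive step favors the
player with the parity of `k`, so for odd `k` the players are exchanged by complementing `T`. -/
theorem exists_solves [Finite P] (k : ℕ) : ∀ T : P → P → Prop, ∃ (W : Set P) (s t : P → P),
    H.Solves k 0 T W s ∧ H.Solves k 1 (fun p q => ¬ T p q) Wᶜ t := by
  induction k with
  | zero =>
    intro T
    classical
    let W : Set P := {p | (H.owner p = 0 ∧ ∃ q, H.Edge p q ∧ T p q) ∨
      (H.owner p ≠ 0 ∧ ∀ q, H.Edge p q → T p q)}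
    have h0 : ∀ p, ∃ q, p ∈ W → H.owner p = 0 → H.Edge p q ∧ T p q := by
      intro p
      by_cases h : p ∈ W ∧ H.owner p = 0
      · rcases h.1 with ⟨_, q, hq⟩ | ⟨h', _⟩
        · exact ⟨q, fun _ _ => hq⟩
        · exact absurd h.2 h'
      · exact ⟨p, fun h1 h2 => absurd ⟨h1, h2⟩ h⟩
    have h1 : ∀ p, ∃ q, p ∈ Wᶜ → H.owner p = 1 → H.Edge p q ∧ ¬ T p q := by
      intro p
      by_contra hcon
      push Not at hcon
      have := hcon p
      refine this.1 (Or.inr ⟨by rw [this.2.1]; decide, fun q hq => ?_⟩)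
      exact (hcon q).2.2 hq
    choose s hs using h0
    choose t ht using h1
    refine ⟨W, s, t, ⟨fun p hp ho => ?_, fun p hp ho q hE => ?_, fun ρ _ _ hc _ => ?_⟩,
      ⟨fun p hp ho => ?_, fun p hp ho q hE => ?_, fun ρ _ _ hc _ => ?_⟩⟩
    · exact ⟨(hs p hp ho).1, fun h => absurd h (Nat.not_lt_zero _), fun _ => (hs p hp ho).2⟩
    · rcases hp with ⟨h, _⟩ | ⟨_, h⟩
      · exact absurd h ho
      · exact ⟨fun h => absurd h (Nat.not_lt_zero _), fun _ => h q hE⟩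
    · exact absurd (hc 0) (Nat.not_lt_zero _)
    · exact ⟨(ht p hp ho).1, fun h => absurd h (Nat.not_lt_zero _), fun _ => (ht p hp ho).2⟩
    · have ho' : H.owner p = 0 := (Player.eq_or_eq (by decide) _).resolve_right ho
      exact ⟨fun h => absurd h (Nat.not_lt_zero _), fun _ hT => hp (Or.inl ⟨ho', q, hE, hT⟩)⟩
    · exact absurd (hc 0) (Nat.not_lt_zero _)
  | succ k ih =>
    intro T
    rcases Nat.mod_two_eq_zero_or_one k with hk | hk
    · exact exists_solves_succ (by decide) hk ih T
    · obtain ⟨W, s, t, h⟩ := exists_solves_succ (i := 1) (j := 0) (by decide) hk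
        (fun T => by
          obtain ⟨W, s, t, h⟩ := ih fun p q => ¬ T p q
          exact Solves.compl_swap h) (fun p q => ¬ T p q)
      exact Solves.compl_swap h

/-- Positional determinacy: if all colors are less than `k`, then each position is in the winning
region `W i` of one of the players, and each player has a uniform positional strategy winning from
every position in his winning region. -/
theorem exists_positional [Finite P] {k : ℕ} (hk : ∀ p q, H.color p q < k) :
    ∃ (W : Player → Set P) (s : Player → P → P), (∀ p, p ∈ W 0 ∨ p ∈ W 1) ∧ ∀ i,
      (∀ p ∈ W i, H.owner p = i → H.Edge p (s i p)) ∧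
      ∀ ρ : ℕ → P, ρ 0 ∈ W i → (∀ n, H.Edge (ρ n) (ρ (n + 1))) →
        (∀ n, ρ n ∈ W i → H.owner (ρ n) = i → ρ (n + 1) = s i (ρ n)) →
        ParityWin i fun n => H.color (ρ n) (ρ (n + 1)) := by
  -- All colors are below `k`, so no edge ever consults the stopping condition and any choice of it
  -- serves.
  obtain ⟨W, s, t, hs, ht⟩ := exists_solves (H := H) k fun _ _ => True
  have main : ∀ {i : Player} {T : P → P → Prop} {W : Set P} {s : P → P}, H.Solves k i T W s →
      (∀ p ∈ W, H.owner p = i → H.Edge p (s p)) ∧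
      ∀ ρ : ℕ → P, ρ 0 ∈ W → (∀ n, H.Edge (ρ n) (ρ (n + 1))) →
        (∀ n, ρ n ∈ W → H.owner (ρ n) = i → ρ (n + 1) = s (ρ n)) →
        ParityWin i fun n => H.color (ρ n) (ρ (n + 1)) := by
    intro i T W s h
    refine ⟨fun p hp ho => (h.own p hp ho).1, fun ρ h0 hE hc => ?_⟩
    have hW : ∀ n, ρ n ∈ W := by
      intro n
      induction n with
      | zero => exact h0
      | succ n ih => exact (h.safe ih (hE n) (hc n ih)).1 (hk _ _)
    exact h.win ρ hW hE (fun n => hk _ _) fun n => hc n (hW n)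
  refine ⟨![W, Wᶜ], ![s, t], fun p => em _, fun i => ?_⟩
  fin_cases i
  · exact main hs
  · exact main ht

end EdgeGame

/-! ### Plays of strategy pairs, padding of memory, and products with memory. -/

variable {V : Type*}

/-- The history of length `n` of the play that starts in `A.init` and follows `next`, together with
the last vertex. -/
def Arena.history (A : Arena V) (next : List V → V → V) : ℕ → List V × V
  | 0 => ([], A.init)
  | n + 1 => ((A.history next n).1 ++ [(A.history next n).2],
      next (A.history next n).1 (A.history next n).2)

namespace Arena.Strategy

variable {A : Arena V}

theorem exists_consistentPlay (σ : A.Strategy 0) (τ : A.Strategy 1) :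
    ∃ ρ : ℕ → V, σ.ConsistentPlay ρ ∧ τ.ConsistentPlay ρ := by
  have h1 : ∀ {v}, A.owner v ≠ 0 → A.owner v = 1 := fun h =>
    (Player.eq_or_eq (by decide) _).resolve_left h
  let next : List V → V → V := fun w v =>
    if h : A.owner v = 0 then σ.move w ⟨v, h⟩ else τ.move w ⟨v, h1 h⟩
  let ρ : ℕ → V := fun n => (A.history next n).2
  have hhist : ∀ n, (A.history next n).1 = (List.range n).map ρ := by
    intro n
    induction n with
    | zero => rfl
    | succ n ih => rw [List.range_succ, List.map_append, ← ih]; rfl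
  have hρ : ∀ n, ρ (n + 1) = next ((List.range n).map ρ) (ρ n) := fun n => by
    rw [← hhist]; rfl
  have hplay : A.IsPlay ρ := by
    refine ⟨rfl, fun n => ?_⟩
    rw [hρ]
    dsimp only [next]
    split_ifs with h
    · exact σ.legal _ ⟨ρ n, h⟩
    · exact τ.legal _ ⟨ρ n, h1 h⟩
  refine ⟨ρ, ⟨hplay, fun n h => ?_⟩, ⟨hplay, fun n h => ?_⟩⟩
  · rw [hρ]; exact dif_pos h
  · rw [hρ]; exact dif_neg (by rw [h]; decide)

theorem HasMemory.mono {i : Player} {σ : A.Strategy i} {k k' : ℕ} (h : σ.HasMemory k)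
    (hk : k ≤ k') : σ.HasMemory k' := by
  obtain ⟨M, _, mem, hM, nxt, hl, hm⟩ := h
  have hcard : Fintype.card M ≤ Fintype.card (Fin k') := by rw [hM, Fintype.card_fin]; exact hk
  obtain ⟨e⟩ := Function.Embedding.nonempty_of_card_le hcard
  have : Nonempty M := ⟨mem.init⟩
  let g := Function.invFun e
  have hg : ∀ m, g (e m) = m := Function.leftInverse_invFun e.injective
  let mem' : MemoryStructure V (Fin k') := ⟨e mem.init, fun m v v' => e (mem.upd (g m) v v')⟩
  have hupd : ∀ (w : List V) (m : Fin k'), g (mem'.updPlus m w) = mem.updPlus (g m) w := by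
    intro w
    induction w with
    | nil => intro m; rfl
    | cons v w ih =>
      intro m
      cases w with
      | nil => rfl
      | cons v' w =>
        simp only [MemoryStructure.updPlus]
        rw [ih]
        simp only [mem', hg]
  refine ⟨Fin k', inferInstance, mem', Fintype.card_fin _, fun v m => nxt v (g m),
    fun v m => hl _ _, fun w v => ?_⟩
  dsimp only
  rw [hm, hupd]
  simp only [mem', hg]

theorem exists_hasMemory_one (A : Arena V) (i : Player) : ∃ σ : A.Strategy i, σ.HasMemory 1 := by
  choose f hf using A.nonterminal
  exact ⟨⟨fun _ v => f v.1, fun _ v => hf v.1⟩, Unit, inferInstance, ⟨(), fun _ _ _ => ()⟩, rfl,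
    fun v _ => f v.1, fun v _ => hf v.1, fun _ _ => rfl⟩

end Arena.Strategy

/-- The memory states assumed along the play `ρ`. -/
def MemoryStructure.run {M : Type*} (mem : MemoryStructure V M) (ρ : ℕ → V) : ℕ → M
  | 0 => mem.init
  | n + 1 => mem.upd (mem.run ρ n) (ρ n) (ρ (n + 1))

theorem MemoryStructure.updPlus_range {M : Type*} (mem : MemoryStructure V M) (ρ : ℕ → V) (n : ℕ) :
    mem.updPlus mem.init ((List.range n).map ρ ++ [ρ n]) = mem.run ρ n := by
  induction n with
  | zero => rfl
  | succ n ih =>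
    rw [List.range_succ, List.map_append, List.append_assoc]
    exact (mem.updPlus_append _ _ _ _).trans (by rw [ih]; rfl)

/-- Parity games played in the product of a finite arena and a finite memory structure are
determined with strategies implemented by this memory structure. -/
theorem Arena.exists_strategy_parityWin [Finite V] {M : Type} [Fintype M] (A : Arena V)
    (mem : MemoryStructure V M) (color : V → M → V → ℕ) {k : ℕ} (hk : ∀ v m v', color v m v' < k) :
    ∃ i : Player, ∃ σ : A.Strategy i, σ.HasMemory (Fintype.card M) ∧
      ∀ ρ, σ.ConsistentPlay ρ → ParityWin i fun n => color (ρ n) (mem.run ρ n) (ρ (n + 1)) := by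
  classical
  let H : EdgeGame (V × M) :=
    { owner := fun p => A.owner p.1
      Edge := fun p q => A.Edge p.1 q.1 ∧ q.2 = mem.upd p.2 p.1 q.1
      color := fun p q => color p.1 p.2 q.1
      nonterminal := fun p => by
        obtain ⟨v, hv⟩ := A.nonterminal p.1
        exact ⟨(v, mem.upd p.2 p.1 v), hv, rfl⟩ }
  obtain ⟨W, s, hW, hs⟩ := H.exists_positional (k := k) fun p q => hk _ _ _
  obtain ⟨i, hi⟩ : ∃ i, (A.init, mem.init) ∈ W i := by
    rcases hW (A.init, mem.init) with h | h
    · exact ⟨0, h⟩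
    · exact ⟨1, h⟩
  choose f hf using A.nonterminal
  -- The fallback `f` only ensures legality outside the winning region.
  let nxt : {v : V // A.owner v = i} → M → V := fun v m =>
    if A.Edge v.1 (s i (v.1, m)).1 then (s i (v.1, m)).1 else f v.1
  have hnxt : ∀ v m, A.Edge v.1 (nxt v m) := by
    intro v m
    dsimp only [nxt]
    split_ifs with h
    · exact h
    · exact hf _
  refine ⟨i, ⟨fun w v => nxt v (mem.updPlus mem.init (w ++ [v.1])), fun w v => hnxt _ _⟩,
    ⟨M, inferInstance, mem, rfl, nxt, hnxt, fun _ _ => rfl⟩, fun ρ hρ => ?_⟩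
  refine (hs i).2 (fun n => (ρ n, mem.run ρ n)) ?_ (fun n => ⟨hρ.1.2 n, rfl⟩) fun n hn ho => ?_
  · have h0 : (ρ 0, mem.run ρ 0) = (A.init, mem.init) := Prod.ext hρ.1.1 rfl
    exact h0 ▸ hi
  · have h1 := hρ.2 n ho
    have hE := (hs i).1 _ hn ho
    simp only [MemoryStructure.updPlus_range, nxt] at h1
    rw [if_pos hE.1] at h1
    refine Prod.ext h1 ?_
    rw [hE.2, ← h1]
    rfl

/-! ### The memory of open requests and its overflows. -/

namespace Game

theorem cost₁_le_cost₀ (G : Game V) (σ : G.toArena.Strategy 0) (τ : G.toArena.Strategy 1) :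
    G.cost₁ τ ≤ G.cost₀ σ := by
  obtain ⟨ρ, hσ, hτ⟩ := σ.exists_consistentPlay τ
  exact (iInf₂_le ρ hτ).trans (le_iSup₂ (f := fun ρ _ => G.playCost ρ) ρ hσ)

/-- The odd colors occurring in `G`. -/
abbrev OddColor (G : Game V) : Type := {c : ℕ // Odd c ∧ ∃ v, G.color v = c}

/-- For each odd color the cost accumulated by its oldest open request, if there is one; costs are
bounded by `b`. -/
abbrev Requests (G : Game V) (b : ℕ) : Type := G.OddColor → Option (Fin (b + 1))

variable (G : Game V) {b : ℕ}

/-- Traversing an edge of cost `w` lets the cost of some open request exceed `b`. -/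
def Overflow (r : G.Requests b) (w : ℕ) : Prop := ∃ c x, r c = some x ∧ b < x.val + w

open Classical in
/-- The open requests after traversing an edge of cost `w`, before visiting its target. All
requests are dropped if an overflow occurs. -/
noncomputable def traverse (r : G.Requests b) (w : ℕ) : G.Requests b := fun c =>
  if G.Overflow r w then none
  -- Without overflow the truncation at `b` has no effect; it only keeps the value in range.
  else (r c).map fun x => ⟨min (x.val + w) b, Nat.lt_succ_of_le (min_le_right _ _)⟩

open Classical in
/-- The open requests after visiting a vertex of color `a`. -/
noncomputable def visit (a : ℕ) (r : G.Requests b) : G.Requests b := fun c =>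
  -- A recurring color keeps the cost of its older open request, which is the larger one.
  if a ∈ answer c.1 then none else if a = c.1 then some ((r c).getD 0) else r c

/-- The memory structure that keeps track of the open requests and their costs. -/
noncomputable def requestMemory (b : ℕ) : MemoryStructure V (G.Requests b) where
  init := G.visit (G.color G.init) fun _ => none
  upd r v v' := G.visit (G.color v') (G.traverse r (G.cost v v'))

open Classical in
/-- The color `B` for overflows, and the color of the source for all other edges. -/
noncomputable def overflowColor (b B : ℕ) (v : V) (r : G.Requests b) (v' : V) : ℕ :=
  if G.Overflow r (G.cost v v') then B else G.color v

theorem visit_eq_some {a : ℕ} {r : G.Requests b} {c : G.OddColor} {x : Fin (b + 1)}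
    (h : G.visit a r c = some x) : a ∉ answer c.1 ∧ ((a = c.1 ∧ x = 0) ∨ r c = some x) := by
  unfold visit at h
  split_ifs at h with h1 h2
  · refine ⟨h1, ?_⟩
    cases hr : r c with
    | none => rw [hr] at h; exact Or.inl ⟨h2, by simpa using h.symm⟩
    | some y => rw [hr] at h; exact Or.inr (by simpa using h)
  · exact ⟨h1, Or.inr h⟩

theorem visit_of_some {a : ℕ} {r : G.Requests b} {c : G.OddColor} {x : Fin (b + 1)}
    (ha : a ∉ answer c.1) (h : r c = some x) : G.visit a r c = some x := by
  unfold visit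
  rw [if_neg ha]
  split_ifs
  · rw [h]; rfl
  · exact h

theorem exists_visit_self {c : G.OddColor} (r : G.Requests b) :
    ∃ x, G.visit c.1 r c = some x := by
  unfold visit
  rw [if_neg (fun h => Nat.not_even_iff_odd.mpr c.2.1 h.2), if_pos rfl]
  exact ⟨_, rfl⟩

theorem traverse_eq_some {r : G.Requests b} {w : ℕ} {c : G.OddColor} {x : Fin (b + 1)}
    (h : G.traverse r w c = some x) :
    ¬ G.Overflow r w ∧ ∃ y, r c = some y ∧ x.val = y.val + w := by
  unfold traverse at h
  split_ifs at h with h1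
  refine ⟨h1, ?_⟩
  rw [Option.map_eq_some_iff] at h
  obtain ⟨y, hy, rfl⟩ := h
  refine ⟨y, hy, ?_⟩
  have : ¬ b < y.val + w := fun h => h1 ⟨c, y, hy, h⟩
  exact min_eq_left (not_lt.mp this)

theorem traverse_of_some {r : G.Requests b} {w : ℕ} (h : ¬ G.Overflow r w) {c : G.OddColor}
    {y : Fin (b + 1)} (hy : r c = some y) :
    ∃ x : Fin (b + 1), G.traverse r w c = some x ∧ x.val = y.val + w := by
  have hle : ¬ b < y.val + w := fun h' => h ⟨c, y, hy, h'⟩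
  refine ⟨_, by unfold traverse; rw [if_neg h, hy]; rfl, ?_⟩
  exact min_eq_left (not_lt.mp hle)

theorem infixCost_self (ρ : ℕ → V) (j : ℕ) : G.infixCost ρ j j = 0 := by
  simp [infixCost]

theorem infixCost_succ (ρ : ℕ → V) {j n : ℕ} (h : j ≤ n) :
    G.infixCost ρ j (n + 1) = G.infixCost ρ j n + G.cost (ρ n) (ρ (n + 1)) :=
  Finset.sum_Ico_succ_top h _

theorem infixCost_mono (ρ : ℕ → V) (j : ℕ) {n n' : ℕ} (h : n ≤ n') :
    G.infixCost ρ j n ≤ G.infixCost ρ j n' :=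
  Finset.sum_le_sum_of_subset (Finset.Ico_subset_Ico_right h)

theorem le_cor {ρ : ℕ → V} {j n a : ℕ}
    (h : ∀ j', j ≤ j' → j' < n → G.color (ρ j') ∉ answer (G.color (ρ j)))
    (ha : a ≤ G.infixCost ρ j n) : (a : ℕ∞) ≤ G.cor ρ j := by
  refine le_iInf₂ fun j' hj' => ?_
  have : n ≤ j' := by
    by_contra hcon
    exact h j' hj'.1 (not_le.mp hcon) hj'.2
  exact_mod_cast ha.trans (G.infixCost_mono ρ j this)

theorem cor_eq_top {ρ : ℕ → V} {j : ℕ}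
    (h : ∀ j', j ≤ j' → G.color (ρ j') ∉ answer (G.color (ρ j))) : G.cor ρ j = ⊤ :=
  iInf₂_eq_top.mpr fun j' hj' => absurd hj'.2 (h j' hj'.1)

theorem cor_le {ρ : ℕ → V} {j j' : ℕ} (hj : j ≤ j')
    (h : G.color (ρ j') ∈ answer (G.color (ρ j))) : G.cor ρ j ≤ (G.infixCost ρ j j' : ℕ∞) :=
  iInf₂_le (f := fun j' _ => (G.infixCost ρ j j' : ℕ∞)) j' ⟨hj, h⟩

/-- Every cost stored after an overflow belongs to a request opened after this overflow. -/
theorem exists_request_of_run_eq_some {ρ : ℕ → V} {N n : ℕ}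
    (hN : G.Overflow ((G.requestMemory b).run ρ N) (G.cost (ρ N) (ρ (N + 1)))) (hn : N < n)
    {c : G.OddColor} {x : Fin (b + 1)} (hx : (G.requestMemory b).run ρ n c = some x) :
    ∃ j, N < j ∧ j ≤ n ∧ G.color (ρ j) = c.1 ∧ x.val = G.infixCost ρ j n ∧
      ∀ j', j ≤ j' → j' ≤ n → G.color (ρ j') ∉ answer c.1 := by
  induction n generalizing x with
  | zero => omega
  | succ n ih =>
    have hx' : G.visit (G.color (ρ (n + 1))) (G.traverse ((G.requestMemory b).run ρ n)
      (G.cost (ρ n) (ρ (n + 1)))) c = some x := hx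
    obtain ⟨ha, h | h⟩ := G.visit_eq_some hx'
    · refine ⟨n + 1, hn, le_rfl, h.1, by rw [h.2, infixCost_self]; rfl, fun j' h1 h2 => ?_⟩
      rwa [le_antisymm h2 h1]
    · obtain ⟨ho, y, hy, hxy⟩ := G.traverse_eq_some h
      have hNn : N < n := by
        rcases Nat.lt_succ_iff_lt_or_eq.mp hn with h | rfl
        · exact h
        · exact absurd hN ho
      obtain ⟨j, h1, h2, h3, h4, h5⟩ := ih hNn hy
      refine ⟨j, h1, by omega, h3, by rw [hxy, h4, G.infixCost_succ ρ h2], fun j' hj hj' => ?_⟩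
      rcases Nat.lt_or_ge n j' with h | h
      · rwa [le_antisymm hj' h]
      · exact h5 j' hj h

theorem lt_playCost_of_frequently_overflow {ρ : ℕ → V}
    (h : ∃ᶠ n in atTop, G.Overflow ((G.requestMemory b).run ρ n) (G.cost (ρ n) (ρ (n + 1)))) :
    ((b + 1 : ℕ) : ℕ∞) ≤ G.playCost ρ := by
  refine le_limsup_of_frequently_le' ?_
  rw [frequently_atTop] at h ⊢
  intro a
  obtain ⟨N, haN, hN⟩ := h a
  -- The request behind a second overflow was opened after the first one, hence beyond `a`.
  obtain ⟨n, hn, c, x, hx, hb⟩ := h (N + 1)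
  obtain ⟨j, h1, h2, h3, h4, h5⟩ := G.exists_request_of_run_eq_some hN hn hx
  refine ⟨j, by omega, G.le_cor (n := n + 1) (fun j' hj hj' => ?_) ?_⟩
  · rw [h3]
    exact h5 j' hj (by omega)
  · rw [G.infixCost_succ ρ h2, ← h4]
    omega

/-- In the absence of overflows the costs of all open requests are accounted for. -/
theorem infixCost_le_run {ρ : ℕ → V} {N : ℕ}
    (hN : ∀ n, N ≤ n → ¬ G.Overflow ((G.requestMemory b).run ρ n) (G.cost (ρ n) (ρ (n + 1))))
    {j n : ℕ} (hj : N < j) (hn : j ≤ n) {c : G.OddColor} (hc : G.color (ρ j) = c.1)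
    (ha : ∀ j', j ≤ j' → j' ≤ n → G.color (ρ j') ∉ answer c.1) :
    ∃ x : Fin (b + 1), (G.requestMemory b).run ρ n c = some x ∧ G.infixCost ρ j n ≤ x.val := by
  induction n, hn using Nat.le_induction with
  | base =>
    obtain ⟨j, rfl⟩ := Nat.exists_eq_succ_of_ne_zero (by omega : j ≠ 0)
    obtain ⟨x, hx⟩ := G.exists_visit_self (c := c)
      (G.traverse ((G.requestMemory b).run ρ j) (G.cost (ρ j) (ρ (j + 1))))
    rw [← hc] at hx
    exact ⟨x, hx, by rw [infixCost_self]; exact Nat.zero_le _⟩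
  | succ n hn ih =>
    obtain ⟨y, hy, hle⟩ := ih fun j' h h' => ha j' h (by omega)
    obtain ⟨x, hx, hxy⟩ := G.traverse_of_some (hN n (by omega)) hy
    refine ⟨x, G.visit_of_some (ha (n + 1) (by omega) le_rfl) hx, ?_⟩
    rw [G.infixCost_succ ρ hn, hxy]
    omega

/-- An odd request stays recorded until just before its first answer, and the edge into the
answering vertex is still tested for overflow. -/
theorem cor_le_of_forall_not_overflow {ρ : ℕ → V} {N : ℕ}
    (hN : ∀ n, N ≤ n → ¬ G.Overflow ((G.requestMemory b).run ρ n) (G.cost (ρ n) (ρ (n + 1))))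
    {j : ℕ} (hj : N < j) (ha : ∃ j', j ≤ j' ∧ G.color (ρ j') ∈ answer (G.color (ρ j))) :
    G.cor ρ j ≤ (b : ℕ∞) := by
  classical
  rcases Nat.even_or_odd (G.color (ρ j)) with he | ho
  · refine (G.cor_le le_rfl ⟨le_rfl, he⟩).trans ?_
    rw [infixCost_self]
    exact_mod_cast Nat.zero_le b
  · obtain ⟨h1, h2⟩ := Nat.find_spec ha
    have hmin := fun m => Nat.find_min (H := ha) (m := m)
    set j' := Nat.find ha
    have hne : j ≠ j' := fun h => by
      rw [← h] at h2
      exact Nat.not_even_iff_odd.mpr ho h2.2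
    obtain ⟨n, hn⟩ := Nat.exists_eq_succ_of_ne_zero (by omega : j' ≠ 0)
    let c : G.OddColor := ⟨G.color (ρ j), ho, _, rfl⟩
    obtain ⟨x, hx, hle⟩ := G.infixCost_le_run hN hj (n := n) (by omega) (c := c) rfl
      fun m hm hm' h => hmin m (by omega) ⟨hm, h⟩
    refine (G.cor_le h1 h2).trans ?_
    have hb : ¬ b < x.val + G.cost (ρ n) (ρ (n + 1)) := fun h => hN n (by omega) ⟨c, x, hx, h⟩
    have : G.infixCost ρ j j' ≤ b := by
      rw [hn, G.infixCost_succ ρ (by omega)]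
      omega
    exact_mod_cast this

/-- The maximal recurring color is even, hence not `B`: overflows cease, and that color answers all
late requests. -/
theorem playCost_le_of_parityWin {ρ : ℕ → V} {B : ℕ} (hB : Odd B) (hlt : ∀ v, G.color v < B)
    (h : ParityWin 0 fun n =>
      G.overflowColor b B (ρ n) ((G.requestMemory b).run ρ n) (ρ (n + 1))) :
    G.playCost ρ ≤ (b : ℕ∞) := by
  obtain ⟨m, hm, hf, he⟩ := h
  have hm : m % 2 = 0 := hm
  rw [Nat.odd_iff] at hB
  have hmB : m < B := by
    obtain ⟨n, hn⟩ := hf.exists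
    dsimp only [overflowColor] at hn
    split_ifs at hn
    · omega
    · rw [← hn]; exact hlt _
  have hno : ∀ n, G.overflowColor b B (ρ n) ((G.requestMemory b).run ρ n) (ρ (n + 1)) ≤ m →
      ¬ G.Overflow ((G.requestMemory b).run ρ n) (G.cost (ρ n) (ρ (n + 1))) ∧
      G.overflowColor b B (ρ n) ((G.requestMemory b).run ρ n) (ρ (n + 1)) = G.color (ρ n) := by
    intro n hn
    unfold overflowColor at hn ⊢
    split_ifs at hn ⊢ with h
    · omega
    · exact ⟨h, rfl⟩
  rw [eventually_atTop] at he
  obtain ⟨N, hN⟩ := he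
  refine limsup_le_of_le (by isBoundedDefault) ?_
  filter_upwards [eventually_gt_atTop N] with j hj
  refine G.cor_le_of_forall_not_overflow (fun n hn => (hno n (hN n hn)).1) hj ?_
  rw [frequently_atTop] at hf
  obtain ⟨j', hj', hcol⟩ := hf j
  have h1 := hN j hj.le
  dsimp only at h1
  rw [(hno j h1).2] at h1
  dsimp only at hcol
  rw [(hno j' (hN j' (by omega))).2] at hcol
  exact ⟨j', hj', by rw [hcol]; exact h1, by rw [hcol]; exact Nat.even_iff.mpr hm⟩

/-- If overflows cease, the maximal recurring color is an odd color of `G`, and its late occurrences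
are never answered. -/
theorem lt_playCost_of_parityWin {ρ : ℕ → V} {B : ℕ}
    (h : ParityWin 1 fun n =>
      G.overflowColor b B (ρ n) ((G.requestMemory b).run ρ n) (ρ (n + 1))) :
    ((b + 1 : ℕ) : ℕ∞) ≤ G.playCost ρ := by
  by_cases hov : ∃ᶠ n in atTop,
      G.Overflow ((G.requestMemory b).run ρ n) (G.cost (ρ n) (ρ (n + 1)))
  · exact G.lt_playCost_of_frequently_overflow hov
  · rw [not_frequently] at hov
    obtain ⟨m, hm, hf, he⟩ := h
    have hm : m % 2 = 1 := hm
    have hcol : ∀ᶠ n in atTop, G.overflowColor b B (ρ n) ((G.requestMemory b).run ρ n) (ρ (n + 1)) =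
        G.color (ρ n) := hov.mono fun n hn => if_neg hn
    have hle : ∀ᶠ n in atTop, G.color (ρ n) ≤ m := by
      filter_upwards [hcol, he] with n h1 h2
      exact h1 ▸ h2
    rw [eventually_atTop] at hle
    obtain ⟨N, hN⟩ := hle
    refine le_limsup_of_frequently_le' ?_
    refine (hf.and_eventually (hcol.and (eventually_ge_atTop N))).mono ?_
    rintro j ⟨h1, h2, hj⟩
    rw [G.cor_eq_top]
    · exact le_top
    · rintro j' hj' ⟨h3, h4⟩
      have := hN j' (by omega)
      dsimp only at h1
      rw [Nat.even_iff] at h4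
      have : G.color (ρ j') = m := by omega
      omega

/-- For every bound `b`, Player 0 enforces costs of at most `b`, or Player 1 enforces costs greater
than `b`, in both cases with a strategy implemented with `(b + 2) ^ d` memory states. -/
theorem exists_hasMemory_or [Finite V] (b : ℕ) :
    (∃ σ : G.toArena.Strategy 0, G.cost₀ σ ≤ (b : ℕ∞) ∧
      σ.HasMemory ((b + 2) ^ G.numOddColors)) ∨
    ∃ τ : G.toArena.Strategy 1, ((b + 1 : ℕ) : ℕ∞) ≤ G.cost₁ τ ∧
      τ.HasMemory ((b + 2) ^ G.numOddColors) := by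
  classical
  have hfin : {c : ℕ | Odd c ∧ ∃ v, G.color v = c}.Finite :=
    (Set.finite_range G.color).subset fun c hc => hc.2
  have : Fintype G.OddColor := hfin.fintype
  have hcard : Fintype.card (G.Requests b) = (b + 2) ^ G.numOddColors := by
    rw [Fintype.card_fun, Fintype.card_option, Fintype.card_fin, numOddColors,
      ← Nat.card_eq_fintype_card]
    rfl
  -- With `a` bounding all colors, `2 * a + 1` is odd and exceeds each of them.
  obtain ⟨a, ha⟩ := (Set.finite_range G.color).bddAbove
  have hlt : ∀ v, G.color v < 2 * a + 1 := fun v => by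
    have := ha (Set.mem_range_self v)
    omega
  obtain ⟨i, σ, hmem, hσ⟩ := G.toArena.exists_strategy_parityWin (G.requestMemory b)
    (G.overflowColor b (2 * a + 1)) (k := 2 * a + 2) fun v r v' => by
      unfold overflowColor
      split_ifs
      · omega
      · have := hlt v
        omega
  rw [hcard] at hmem
  obtain rfl | rfl := Player.eq_or_eq (by decide : (0 : Player) ≠ 1) i
  · exact Or.inl ⟨σ, iSup₂_le fun ρ hρ =>
      G.playCost_le_of_parityWin (odd_two_mul_add_one a) hlt (hσ ρ hρ), hmem⟩
  · exact Or.inr ⟨σ, le_iInf₂ fun ρ hρ => G.lt_playCost_of_parityWin (hσ ρ hρ), hmem⟩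

end Game

end CostParity

/-! ### Both memory bounds from the dichotomy. -/

theorem mainTheorem4 {V : Type*} [Fintype V] (G : CostParity.Game V) (n d b : ℕ)
    (hn : Fintype.card V = n) (hd : G.numOddColors = d) :
    (∀ σ : G.toArena.Strategy 0, G.cost₀ σ = (b : ℕ∞) →
      ∃ σ' : G.toArena.Strategy 0,
        G.cost₀ σ' ≤ (b : ℕ∞) ∧ σ'.HasMemory ((b + 2) ^ d)) ∧
    (∀ τ : G.toArena.Strategy 1, G.cost₁ τ = (b : ℕ∞) →
      ∃ τ' : G.toArena.Strategy 1,
        (b : ℕ∞) ≤ G.cost₁ τ' ∧ τ'.HasMemory (n * (b + 2) ^ d)) := by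
  subst hn hd
  constructor
  · intro σ hσ
    rcases G.exists_hasMemory_or b with h | ⟨τ, hτ, _⟩
    · exact h
    · have h := hτ.trans (G.cost₁_le_cost₀ σ τ)
      rw [hσ, Nat.cast_le] at h
      omega
  · intro τ hτ
    have hpos : 0 < Fintype.card V := Fintype.card_pos_iff.mpr ⟨G.init⟩
    -- Cost at least `b` is what the dichotomy for `b - 1` offers Player 1; for `b = 0` any strategy
    -- will do.
    cases b with
    | zero =>
      obtain ⟨τ', h⟩ := CostParity.Arena.Strategy.exists_hasMemory_one G.toArena 1
      exact ⟨τ', by simp, h.mono (Nat.succ_le_of_lt (by positivity))⟩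
    | succ b =>
      rcases G.exists_hasMemory_or b with ⟨σ, hσ, _⟩ | ⟨τ', hτ', hmem⟩
      · have h := (G.cost₁_le_cost₀ σ τ).trans hσ
        rw [hτ, Nat.cast_le] at h
        omega
      · refine ⟨τ', hτ', hmem.mono ?_⟩
        exact (Nat.pow_le_pow_left (by omega) _).trans (Nat.le_mul_of_pos_left _ hpos)
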